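/- Let $N\ge 1$ be an integer, let $0\le\gamma\le\mu<N$ be real numbers, and let $q_1,q_2\in(1,\infty]$ satisfy (with $1/\infty=0$) $$0\le \frac1{q_2}<\frac{\mu-\gamma}{N}+\frac1{q_1}\le\frac{\mu}{N}+\frac1{q_1}<1 .$$ For $t>0$ let $G_t(x)=(4\pi t)^{-N/2}e^{-|x|^2/(4t)}$, $x\in\mathbb R^N$, and let $e^{t\Delta}u=G_t\star u$, that is, $(e^{t\Delta}u)(x)=\int_{\mathbb R^N}G_t(x-y)\,u(y)\,dy$. Then there is a constant $C>0$, depending only on $N,\gamma,\mu,q_1,q_2$, such that for every $t>0$ and every $u:\mathbb R^N\to\mathbb R$ with $|\cdot|^{\mu}u\in L^{q_1}(\mathbb R^N)$, the integral defining $(e^{t\Delta}u)(x)$ converges absolutely for every $x\in\mathbb R^N$, $|\cdot|^{\gamma}e^{t\Delta}u\in L^{q_2}(\mathbb R^N)$, and $$\big\||\cdot|^{\gamma}e^{t\Delta}u\big\|_{L^{q_2}(\mathbb R^N)}\le C\,t^{-\frac N2\left(\frac1{q_1}-\frac1{q_2}\right)-\frac{\mu-\gamma}{2}}\,\big\||\cdot|^{\mu}u\big\|_{L^{q_1}(\mathbb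 R^N)} .$$ -/

import Mathlib

open MeasureTheory
open scoped ENNReal

noncomputable section

/-- The Gauss (heat) kernel on `ℝ^N`: `G_t(x) = (4πt)^{-N/2} exp(-|x|²/(4t))`, for `t > 0`. -/
def heatKernel (N : ℕ) (t : ℝ) (x : EuclideanSpace ℝ (Fin N)) : ℝ :=
  (4 * Real.pi * t) ^ (-((N : ℝ) / 2)) * Real.exp (-(‖x‖ ^ 2) / (4 * t))

/-- The heat semigroup on `ℝ^N`: `(e^{tΔ} u)(x) = (G_t ⋆ u)(x) = ∫ G_t(x - y) u(y) dy`. -/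
def heatSemigroup (N : ℕ) (t : ℝ) (u : EuclideanSpace ℝ (Fin N) → ℝ)
    (x : EuclideanSpace ℝ (Fin N)) : ℝ :=
  ∫ y, heatKernel N t (x - y) * u y

/-- The function `|·|^γ f` on `ℝ^N`; its `L^q` norm is the norm of `f` in the weighted space
`L^q_γ(ℝ^N)`. -/
def weighted (N : ℕ) (γ : ℝ) (f : EuclideanSpace ℝ (Fin N) → ℝ)
    (x : EuclideanSpace ℝ (Fin N)) : ℝ :=
  ‖x‖ ^ γ * f x

end

/-! Dilation by `l = √t` reduces everything to time `1`, where `f = |·|^μ u` is cut at the unit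
sphere. Since `|x| ≤ |x - y| + |y| ≤ (1 + |x - y|) max(1, |y|)`, the weight `|x|^γ` is absorbed into
`momentKernel`, `(1 + |z|)^γ G_1(z)`, at the cost of `|y|^γ` outside the ball only
(`weight_mul_enorm_le`).

It remains to convolve this kernel with `|y|^{-μ} f` inside and `|y|^{-(μ-γ)} f` outside. By Hölder
the former is in `L^1`, because `μ/N + 1/q₁ < 1`, and the latter in `L^{min(q₁,q₂)}`, because `1/q₂
< (μ-γ)/N + 1/q₁`. The kernel is bounded and integrable, so it maps both spaces into `L^{q₂}`
(`eLpNorm_lintegral_convolution_le`) and into bounded functions; the latter gives absolute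
convergence at every point. -/

section Convolution

/-! ### Convolution with a bounded integrable kernel -/

variable {E : Type*} [NormedAddCommGroup E] [MeasurableSpace E] [BorelSpace E]
  [SecondCountableTopology E] {ν : Measure E} {k : E → ℝ≥0∞} {A : ℝ≥0∞}

lemma aemeasurable_kernel_mul (hk : Measurable k) {g : E → ℝ≥0∞}
    (hg : AEMeasurable g ν) :
    AEMeasurable (fun z : E × E => k (z.1 - z.2) * g z.2) (ν.prod ν) :=
  (hk.comp (measurable_fst.sub measurable_snd)).aemeasurable.mul hg.comp_snd

variable [ν.IsAddLeftInvariant] [ν.IsNegInvariant]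

/-- Jensen's inequality for averages against a kernel of mass at most `A`. -/
lemma lintegral_mul_enorm_le_withDensity (hk : Measurable k) {g : E → ℝ}
    (hg : AEStronglyMeasurable g ν) (hkI : ∫⁻ x, k x ∂ν ≤ A) {r : ℝ≥0∞} (hr : 1 ≤ r) (x : E) :
    ∫⁻ y, k (x - y) * ‖g y‖ₑ ∂ν ≤
      eLpNorm g r (ν.withDensity fun y => k (x - y)) * A ^ (1 - 1 / r.toReal) := by
  have hkx : Measurable fun y => k (x - y) := hk.comp (measurable_const.sub measurable_id)
  have h1 := eLpNorm_le_eLpNorm_mul_rpow_measure_univ hr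
    (hg.mono_ac (withDensity_absolutelyContinuous ν fun y => k (x - y)))
  rw [eLpNorm_one_eq_lintegral_enorm, lintegral_withDensity_eq_lintegral_mul₀ hkx.aemeasurable
    hg.enorm] at h1
  refine h1.trans ?_
  rw [ENNReal.toReal_one, div_one, withDensity_apply _ MeasurableSet.univ, Measure.restrict_univ,
    lintegral_sub_left_eq_self]
  refine mul_le_mul_right (ENNReal.rpow_le_rpow hkI ?_) _
  rcases eq_or_ne r ⊤ with rfl | h
  · simp
  · have : 1 ≤ r.toReal := by
      rw [← ENNReal.toReal_one]; exact ENNReal.toReal_mono h hr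
    rw [sub_nonneg, div_le_one (by linarith)]
    exact this

/-- The measure `k(x - ·) ν` is at most `A • ν`, so Jensen's bound costs `A^{1/r}` for the norm and
`A^{1-1/r}` for the mass. This is the endpoint `L^r → L^∞`. -/
lemma lintegral_convolution_le (hk : Measurable k) (hA0 : A ≠ 0) (hA : A ≠ ⊤)
    (hkA : ∀ x, k x ≤ A) (hkI : ∫⁻ x, k x ∂ν ≤ A) {g : E → ℝ}
    (hg : AEStronglyMeasurable g ν) {r : ℝ≥0∞} (hr : 1 ≤ r) (x : E) :
    ∫⁻ y, k (x - y) * ‖g y‖ₑ ∂ν ≤ A * eLpNorm g r ν := by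
  refine (lintegral_mul_enorm_le_withDensity hk hg hkI hr x).trans ?_
  have h2 : ν.withDensity (fun y => k (x - y)) ≤ A • ν := by
    rw [← withDensity_const]
    exact withDensity_mono (Filter.Eventually.of_forall fun y => hkA _)
  calc _ ≤ (A ^ (1 / r.toReal) * eLpNorm g r ν) * A ^ (1 - 1 / r.toReal) := by
        gcongr
        refine (eLpNorm_mono_measure g h2).trans_eq ?_
        rw [eLpNorm_smul_measure_of_ne_zero hA0, smul_eq_mul, ENNReal.toReal_div,
          ENNReal.toReal_one]
    _ = (A ^ (1 / r.toReal) * A ^ (1 - 1 / r.toReal)) * eLpNorm g r ν := by ring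
    _ = _ := by
        rw [← ENNReal.rpow_add _ _ hA0 hA]; simp

lemma lintegral_convolution_rpow_le (hk : Measurable k)
    (hkI : ∫⁻ x, k x ∂ν ≤ A) {g : E → ℝ}
    (hg : AEStronglyMeasurable g ν) {r : ℝ≥0∞} (hr : 1 ≤ r) (hr' : r ≠ ⊤) (x : E) :
    (∫⁻ y, k (x - y) * ‖g y‖ₑ ∂ν) ^ r.toReal ≤
      A ^ (r.toReal - 1) * ∫⁻ y, k (x - y) * ‖g y‖ₑ ^ r.toReal ∂ν := by
  have hr0 : r ≠ 0 := (zero_lt_one.trans_le hr).ne'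
  have hp : 0 < r.toReal := ENNReal.toReal_pos hr0 hr'
  have hkx : Measurable fun y => k (x - y) := hk.comp (measurable_const.sub measurable_id)
  calc _ ≤ (eLpNorm g r (ν.withDensity fun y => k (x - y)) * A ^ (1 - 1 / r.toReal)) ^ r.toReal :=
        ENNReal.rpow_le_rpow (lintegral_mul_enorm_le_withDensity hk hg hkI hr x) hp.le
    _ = _ := by
        rw [ENNReal.mul_rpow_of_nonneg _ _ hp.le, eLpNorm_eq_lintegral_rpow_enorm_toReal hr0 hr',
          ← ENNReal.rpow_mul, ← ENNReal.rpow_mul, one_div_mul_cancel hp.ne', ENNReal.rpow_one,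
          lintegral_withDensity_eq_lintegral_mul₀ hkx.aemeasurable (hg.enorm.pow_const _),
          sub_mul, one_div_mul_cancel hp.ne', one_mul, mul_comm]
        rfl

variable [SFinite ν]

/-- A kernel that is bounded and integrable maps `L^r` to `L^q` whenever `r ≤ q`. -/
lemma eLpNorm_lintegral_convolution_le (hk : Measurable k) (hA0 : A ≠ 0) (hA : A ≠ ⊤)
    (hkA : ∀ x, k x ≤ A) (hkI : ∫⁻ x, k x ∂ν ≤ A) {g : E → ℝ}
    (hg : AEStronglyMeasurable g ν) {r q : ℝ≥0∞} (hr : 1 ≤ r) (hrq : r ≤ q) :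
    eLpNorm (fun x => ∫⁻ y, k (x - y) * ‖g y‖ₑ ∂ν) q ν ≤ A * eLpNorm g r ν := by
  have hpt := lintegral_convolution_le hk hA0 hA hkA hkI hg hr
  rcases eq_or_ne q ⊤ with rfl | hq
  · rw [eLpNorm_exponent_top]
    exact essSup_le_of_ae_le _ (Filter.Eventually.of_forall hpt)
  have hr' : r ≠ ⊤ := ne_top_of_le_ne_top hq hrq
  have hr0 : r ≠ 0 := (zero_lt_one.trans_le hr).ne'
  have hq0 : q ≠ 0 := (zero_lt_one.trans_le (hr.trans hrq)).ne'
  have hp : 0 < r.toReal := ENNReal.toReal_pos hr0 hr'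
  have hp1 : 1 ≤ r.toReal := by
    rw [← ENNReal.toReal_one]; exact ENNReal.toReal_mono hr' hr
  have hpq : r.toReal ≤ q.toReal := ENNReal.toReal_mono hq hrq
  have hs : 0 < q.toReal := hp.trans_le hpq
  set Φ : E → ℝ≥0∞ := fun x => ∫⁻ y, k (x - y) * ‖g y‖ₑ ∂ν
  -- The endpoint `L^r → L^r`: Jensen pointwise, then Tonelli.
  have key : ∫⁻ x, Φ x ^ r.toReal ∂ν ≤ (A * eLpNorm g r ν) ^ r.toReal := by
    calc ∫⁻ x, Φ x ^ r.toReal ∂ν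
        ≤ ∫⁻ x, A ^ (r.toReal - 1) * ∫⁻ y, k (x - y) * ‖g y‖ₑ ^ r.toReal ∂ν ∂ν :=
          lintegral_mono fun x => lintegral_convolution_rpow_le hk hkI hg hr hr' x
      _ = A ^ (r.toReal - 1) * ∫⁻ x, ∫⁻ y, k (x - y) * ‖g y‖ₑ ^ r.toReal ∂ν ∂ν := by
          rw [lintegral_const_mul' _ _ (ENNReal.rpow_ne_top_of_nonneg (by linarith) hA)]
      _ = A ^ (r.toReal - 1) * ∫⁻ y, ∫⁻ x, k (x - y) * ‖g y‖ₑ ^ r.toReal ∂ν ∂ν := by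
          rw [lintegral_lintegral_swap]
          exact aemeasurable_kernel_mul hk (hg.enorm.pow_const _)
      _ ≤ A ^ (r.toReal - 1) * ∫⁻ y, A * ‖g y‖ₑ ^ r.toReal ∂ν := by
          gcongr with y
          rw [lintegral_mul_const _ (by fun_prop)]
          gcongr
          exact (lintegral_sub_right_eq_self k y).trans_le hkI
      _ = _ := by
          rw [lintegral_const_mul' _ _ hA, ← mul_assoc, ENNReal.mul_rpow_of_nonneg _ _ hp.le,
            eLpNorm_eq_lintegral_rpow_enorm_toReal hr0 hr', ← ENNReal.rpow_mul,
            one_div_mul_cancel hp.ne', ENNReal.rpow_one]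
          congr 1
          nth_rw 2 [← ENNReal.rpow_one A]
          rw [← ENNReal.rpow_add _ _ hA0 hA, sub_add_cancel]
  rw [eLpNorm_eq_lintegral_rpow_enorm_toReal hq0 hq, one_div,
    ENNReal.rpow_inv_le_iff hs]
  -- Interpolation between the endpoints: `q - r` powers of `Φ` go to the sup bound, the other `r`
  -- to `key`.
  calc ∫⁻ x, ‖Φ x‖ₑ ^ q.toReal ∂ν
      = ∫⁻ x, Φ x ^ (q.toReal - r.toReal) * Φ x ^ r.toReal ∂ν := by
        refine lintegral_congr fun x => ?_
        rw [← ENNReal.rpow_add_of_nonneg _ _ (by linarith) hp.le, sub_add_cancel]; rfl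
    _ ≤ ∫⁻ x, (A * eLpNorm g r ν) ^ (q.toReal - r.toReal) * Φ x ^ r.toReal ∂ν := by
        gcongr with x
        exact hpt x
    _ = (A * eLpNorm g r ν) ^ (q.toReal - r.toReal) * ∫⁻ x, Φ x ^ r.toReal ∂ν := by
        refine lintegral_const_mul'' _ (AEMeasurable.pow_const ?_ _)
        exact (aemeasurable_kernel_mul hk hg.enorm).lintegral_prod_right'
    _ ≤ (A * eLpNorm g r ν) ^ (q.toReal - r.toReal) * (A * eLpNorm g r ν) ^ r.toReal := by
        gcongr
    _ = _ := by
        rw [← ENNReal.rpow_add_of_nonneg _ _ (by linarith) hp.le, sub_add_cancel]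

end Convolution

/-! ### Integrability of power weights at the origin and at infinity -/

section Weights

variable {N : ℕ}

lemma memLp_indicator_ball_norm_rpow_neg (hN : 1 ≤ N) {α : ℝ} {p : ℝ≥0∞}
    (hp0 : p ≠ 0) (hp : p ≠ ⊤) (h : α * p.toReal < N) :
    MemLp ((Metric.ball (0 : EuclideanSpace ℝ (Fin N)) 1).indicator fun y => ‖y‖ ^ (-α)) p
      volume := by
  have hm : Measurable fun y : EuclideanSpace ℝ (Fin N) => ‖y‖ ^ (-α) := by fun_prop
  rw [memLp_indicator_iff_restrict Metric.isOpen_ball.measurableSet]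
  rw [← integrable_norm_rpow_iff hm.aestronglyMeasurable hp0 hp]
  refine integrableOn_ball_of_norm_le_rpow (C := 1) (α := α * p.toReal) (by simpa using hN)
    (by simpa using h) (Filter.Eventually.of_forall fun x => ?_)
    (hm.norm.pow_const _).aestronglyMeasurable
  rw [Real.norm_of_nonneg (by positivity), Real.norm_of_nonneg (by positivity), one_mul,
    ← Real.rpow_mul (norm_nonneg _), neg_mul]

lemma memLp_indicator_compl_ball_norm_rpow_neg {δ : ℝ} (hδ : 0 ≤ δ) {s : ℝ≥0∞}
    (hs0 : s ≠ 0) (hs : s ≠ ⊤ → N < δ * s.toReal) :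
    MemLp ((Metric.ball (0 : EuclideanSpace ℝ (Fin N)) 1)ᶜ.indicator fun y => ‖y‖ ^ (-δ)) s
      volume := by
  have hm : Measurable fun y : EuclideanSpace ℝ (Fin N) => ‖y‖ ^ (-δ) := by fun_prop
  have hb : MeasurableSet (Metric.ball (0 : EuclideanSpace ℝ (Fin N)) 1)ᶜ :=
    Metric.isOpen_ball.measurableSet.compl
  rcases eq_or_ne s ⊤ with rfl | hs'
  · refine memLp_top_of_bound (hm.indicator hb).aestronglyMeasurable 1
      (Filter.Eventually.of_forall fun x => ?_)
    by_cases hx : x ∈ (Metric.ball (0 : EuclideanSpace ℝ (Fin N)) 1)ᶜ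
    · rw [Set.indicator_of_mem hx, Real.norm_of_nonneg (by positivity)]
      exact Real.rpow_le_one_of_one_le_of_nonpos (by simpa using hx) (by linarith)
    · rw [Set.indicator_of_notMem hx]; simp
  · rw [memLp_indicator_iff_restrict hb, ← integrable_norm_rpow_iff hm.aestronglyMeasurable hs0 hs']
    have h1 : Integrable (fun x : EuclideanSpace ℝ (Fin N) =>
        2 ^ (δ * s.toReal) * (1 + ‖x‖) ^ (-(δ * s.toReal))) volume :=
      (integrable_one_add_norm (by simpa using hs hs')).const_mul _
    refine Integrable.mono' h1.integrableOn
      (hm.norm.pow_const _).aestronglyMeasurable ?_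
    refine (ae_restrict_iff' hb).2 (Filter.Eventually.of_forall fun x hx => ?_)
    have hx1 : 1 ≤ ‖x‖ := by simpa using hx
    rw [Real.norm_of_nonneg (by positivity), Real.norm_of_nonneg (by positivity),
      ← Real.rpow_mul (norm_nonneg _), neg_mul]
    -- Off the ball `1 + |x| ≤ 2|x|`, which explains the factor `2 ^ (δ * s)`.
    calc ‖x‖ ^ (-(δ * s.toReal)) = 2 ^ (δ * s.toReal) * (2 * ‖x‖) ^ (-(δ * s.toReal)) := by
          rw [Real.mul_rpow (by norm_num) (norm_nonneg _), ← mul_assoc,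
            ← Real.rpow_add (by norm_num)]
          simp
      _ ≤ _ := by
          gcongr 2 ^ (δ * s.toReal) * ?_
          exact Real.rpow_le_rpow_of_nonpos (by positivity) (by linarith)
            (neg_nonpos.2 (by positivity))

end Weights

/-! ### Moments of the Gaussian at time 1 -/

section Kernel

variable {N : ℕ}

lemma heatKernel_nonneg {t : ℝ} (ht : 0 < t) (x : EuclideanSpace ℝ (Fin N)) :
    0 ≤ heatKernel N t x := by
  unfold heatKernel; positivity

@[fun_prop]
lemma measurable_heatKernel (t : ℝ) : Measurable (heatKernel N t) := by
  unfold heatKernel; fun_prop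

/-- `(1 + s)^m ≤ e^{ms}`, and `ms - s²/4 = m² - (m - s/2)²`. -/
lemma one_add_rpow_mul_exp_le (m : ℝ) (hm : 0 ≤ m) {s : ℝ} (hs : 0 ≤ s) :
    (1 + s) ^ m * Real.exp (-s ^ 2 / 4) ≤ Real.exp (m ^ 2) := by
  have h1 : (1 + s) ^ m ≤ Real.exp (m * s) := by
    rw [mul_comm, Real.exp_mul]
    exact Real.rpow_le_rpow (by linarith) (by linarith [Real.add_one_le_exp s]) hm
  calc _ ≤ Real.exp (m * s) * Real.exp (-s ^ 2 / 4) := by gcongr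
    _ = Real.exp (m * s + -s ^ 2 / 4) := (Real.exp_add _ _).symm
    _ ≤ _ := Real.exp_le_exp.2 (by nlinarith [sq_nonneg (m - s / 2)])

/-- The kernel `(1 + |z|)^γ G_1(z)`, which dominates `|x|^γ G_1(x - y) max(1, |y|)^{-γ}`. -/
noncomputable def momentKernel (N : ℕ) (γ : ℝ) (z : EuclideanSpace ℝ (Fin N)) : ℝ≥0∞ :=
  ENNReal.ofReal ((1 + ‖z‖) ^ γ * heatKernel N 1 z)

lemma measurable_momentKernel (γ : ℝ) : Measurable (momentKernel N γ) := by
  unfold momentKernel; fun_prop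

lemma exists_bound_momentKernel (N : ℕ) {γ : ℝ} (hγ : 0 ≤ γ) :
    ∃ A : ℝ≥0∞, A ≠ 0 ∧ A ≠ ⊤ ∧ (∀ z, momentKernel N γ z ≤ A) ∧
      ∫⁻ z, momentKernel N γ z ≤ A := by
  -- The Gaussian absorbs `γ + N + 1` powers of `1 + |z|`; the `N + 1` to spare make the majorant
  -- integrable.
  set B : ℝ := (4 * Real.pi * 1) ^ (-((N : ℝ) / 2)) * Real.exp ((γ + (N + 1)) ^ 2)
  have hB : 0 < B := by positivity
  have hle : ∀ z : EuclideanSpace ℝ (Fin N),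
      (1 + ‖z‖) ^ γ * heatKernel N 1 z ≤ B * (1 + ‖z‖) ^ (-((N : ℝ) + 1)) := fun z => by
    have h := one_add_rpow_mul_exp_le (γ + (N + 1)) (by positivity) (norm_nonneg z)
    have h0 : 0 < 1 + ‖z‖ := by positivity
    have e : (1 + ‖z‖) ^ γ =
        (1 + ‖z‖) ^ (γ + ((N : ℝ) + 1)) * (1 + ‖z‖) ^ (-((N : ℝ) + 1)) := by
      rw [← Real.rpow_add h0]; congr 1; ring
    unfold heatKernel
    rw [e, mul_one 4]
    calc _ = (4 * Real.pi * 1) ^ (-((N : ℝ) / 2)) *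
          ((1 + ‖z‖) ^ (γ + ((N : ℝ) + 1)) * Real.exp (-‖z‖ ^ 2 / 4)) *
            (1 + ‖z‖) ^ (-((N : ℝ) + 1)) := by ring
      _ ≤ _ := mul_le_mul_of_nonneg_right (mul_le_mul_of_nonneg_left h (by positivity))
          (by positivity)
  have hint : Integrable (fun z : EuclideanSpace ℝ (Fin N) =>
      B * (1 + ‖z‖) ^ (-((N : ℝ) + 1))) volume :=
    (integrable_one_add_norm (by simp)).const_mul _
  refine ⟨max (ENNReal.ofReal B)
    (∫⁻ z : EuclideanSpace ℝ (Fin N), ENNReal.ofReal (B * (1 + ‖z‖) ^ (-((N : ℝ) + 1)))),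
    ?_, ?_, fun z => ?_, ?_⟩
  · exact (lt_max_of_lt_left (by simpa using hB)).ne'
  · exact (max_lt ENNReal.ofReal_lt_top hint.lintegral_lt_top).ne
  · refine le_max_of_le_left (ENNReal.ofReal_le_ofReal ((hle z).trans ?_))
    refine mul_le_of_le_one_right hB.le ?_
    exact Real.rpow_le_one_of_one_le_of_nonpos (by linarith [norm_nonneg z])
      (neg_nonpos.2 (by positivity))
  · exact le_max_of_le_right (lintegral_mono fun z => ENNReal.ofReal_le_ofReal (hle z))

end Kernel

/-! ### The weighted estimate at time 1 -/

section UnitTime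

variable {N : ℕ}

/-- The part of `|·|^{-α} f` inside the unit ball. -/
noncomputable def innerPart (N : ℕ) (α : ℝ) (f : EuclideanSpace ℝ (Fin N) → ℝ) :
    EuclideanSpace ℝ (Fin N) → ℝ :=
  ((Metric.ball (0 : EuclideanSpace ℝ (Fin N)) 1).indicator fun y => ‖y‖ ^ (-α)) • f

/-- The part of `|·|^{-α} f` outside the unit ball. -/
noncomputable def outerPart (N : ℕ) (α : ℝ) (f : EuclideanSpace ℝ (Fin N) → ℝ) :
    EuclideanSpace ℝ (Fin N) → ℝ :=
  ((Metric.ball (0 : EuclideanSpace ℝ (Fin N)) 1)ᶜ.indicator fun y => ‖y‖ ^ (-α)) • f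

lemma aestronglyMeasurable_innerPart {α : ℝ} {f : EuclideanSpace ℝ (Fin N) → ℝ}
    (hf : AEStronglyMeasurable f volume) : AEStronglyMeasurable (innerPart N α f) volume :=
  AEStronglyMeasurable.smul (Measurable.aestronglyMeasurable <|
    Measurable.indicator (by fun_prop) Metric.isOpen_ball.measurableSet) hf

lemma aestronglyMeasurable_outerPart {α : ℝ} {f : EuclideanSpace ℝ (Fin N) → ℝ}
    (hf : AEStronglyMeasurable f volume) : AEStronglyMeasurable (outerPart N α f) volume :=
  AEStronglyMeasurable.smul (Measurable.aestronglyMeasurable <|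
    Measurable.indicator (by fun_prop) Metric.isOpen_ball.measurableSet.compl) hf

lemma ae_ne_zero (hN : 1 ≤ N) : ∀ᵐ y : EuclideanSpace ℝ (Fin N), y ≠ 0 := by
  have : Nonempty (Fin N) := ⟨⟨0, hN⟩⟩
  exact Measure.ae_ne volume 0

lemma aestronglyMeasurable_of_weighted (hN : 1 ≤ N) {μ : ℝ} {u : EuclideanSpace ℝ (Fin N) → ℝ}
    (hu : AEStronglyMeasurable (weighted N μ u) volume) : AEStronglyMeasurable u volume := by
  have hm : Measurable fun y : EuclideanSpace ℝ (Fin N) => ‖y‖ ^ (-μ) := by fun_prop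
  refine (hm.aestronglyMeasurable.mul hu).congr ?_
  filter_upwards [ae_ne_zero hN] with y hy
  have : 0 < ‖y‖ := norm_pos_iff.2 hy
  simp [weighted, ← mul_assoc, ← Real.rpow_add this]

/-- The pointwise bound of the weighted Gaussian integrand by the inner and the outer parts. -/
lemma weight_mul_enorm_le {γ μ : ℝ} (hγ : 0 ≤ γ) (u : EuclideanSpace ℝ (Fin N) → ℝ)
    (x : EuclideanSpace ℝ (Fin N)) {y : EuclideanSpace ℝ (Fin N)} (hy : y ≠ 0) :
    ENNReal.ofReal (max 1 (‖x‖ ^ γ)) * ‖heatKernel N 1 (x - y) * u y‖ₑ ≤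
      momentKernel N γ (x - y) * ‖innerPart N μ (weighted N μ u) y‖ₑ +
      momentKernel N γ (x - y) * ‖outerPart N (μ - γ) (weighted N μ u) y‖ₑ := by
  have hy0 : 0 < ‖y‖ := norm_pos_iff.2 hy
  have hz : 0 ≤ ‖x - y‖ := norm_nonneg _
  have hx : ‖x‖ ≤ ‖x - y‖ + ‖y‖ := by simpa using norm_add_le (x - y) y
  have hG := heatKernel_nonneg one_pos (x - y)
  unfold momentKernel
  rw [← ofReal_norm, ← ofReal_norm, ← ofReal_norm,
    ← ENNReal.ofReal_mul (by positivity), ← ENNReal.ofReal_mul (by positivity),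
    ← ENNReal.ofReal_mul (by positivity), ← ENNReal.ofReal_add (by positivity) (by positivity)]
  refine ENNReal.ofReal_le_ofReal ?_
  rw [norm_mul, Real.norm_of_nonneg hG]
  by_cases hb : y ∈ Metric.ball (0 : EuclideanSpace ℝ (Fin N)) 1
  · have hy1 : ‖y‖ < 1 := by simpa using hb
    have h1 : max 1 (‖x‖ ^ γ) ≤ (1 + ‖x - y‖) ^ γ :=
      max_le (Real.one_le_rpow (by linarith) hγ)
        (Real.rpow_le_rpow (norm_nonneg _) (by linarith) hγ)
    have h2 : ‖innerPart N μ (weighted N μ u) y‖ = ‖u y‖ := by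
      simp [innerPart, weighted, Set.indicator_of_mem hb,
        ← mul_assoc, ← Real.rpow_add hy0]
    have h3 : ‖outerPart N (μ - γ) (weighted N μ u) y‖ = 0 := by
      simp [outerPart, hy1]
    rw [h2, h3, mul_zero, add_zero, ← mul_assoc]
    gcongr
  · have hy1 : 1 ≤ ‖y‖ := by simpa using hb
    have h1 : max 1 (‖x‖ ^ γ) ≤ (1 + ‖x - y‖) ^ γ * ‖y‖ ^ γ := by
      rw [← Real.mul_rpow (by positivity) hy0.le]
      refine max_le (Real.one_le_rpow (by nlinarith) hγ)
        (Real.rpow_le_rpow (norm_nonneg _) (by nlinarith) hγ)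
    have h2 : ‖innerPart N μ (weighted N μ u) y‖ = 0 := by
      simp [innerPart, hy1]
    have h3 : ‖outerPart N (μ - γ) (weighted N μ u) y‖ = ‖y‖ ^ γ * ‖u y‖ := by
      have hb' : y ∈ (Metric.ball (0 : EuclideanSpace ℝ (Fin N)) 1)ᶜ := hb
      simp only [outerPart, weighted, Pi.smul_apply', Set.indicator_of_mem hb', smul_eq_mul,
        norm_mul, Real.norm_of_nonneg (Real.rpow_nonneg hy0.le _),
        ← mul_assoc, ← Real.rpow_add hy0]
      congr 2; ring
    rw [h2, h3, mul_zero, zero_add]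
    calc _ ≤ ((1 + ‖x - y‖) ^ γ * ‖y‖ ^ γ) * (heatKernel N 1 (x - y) * ‖u y‖) := by gcongr
      _ = _ := by ring

lemma eLpNorm_innerPart_le {μ : ℝ} {q : ℝ≥0∞} (hq : 1 < q)
    {f : EuclideanSpace ℝ (Fin N) → ℝ}
    (hf : AEStronglyMeasurable f volume) :
    eLpNorm (innerPart N μ f) 1 volume ≤
      eLpNorm ((Metric.ball (0 : EuclideanSpace ℝ (Fin N)) 1).indicator fun y => ‖y‖ ^ (-μ))
        (1 - q⁻¹)⁻¹ volume * eLpNorm f q volume := by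
  have hle : q⁻¹ ≤ 1 := ENNReal.inv_le_one.2 hq.le
  have : ENNReal.HolderTriple (1 - q⁻¹)⁻¹ q 1 := ⟨by
    rw [inv_inv, inv_one, tsub_add_cancel_of_le hle]⟩
  exact eLpNorm_smul_le_mul_eLpNorm hf (Measurable.aestronglyMeasurable <|
    Measurable.indicator (by fun_prop) Metric.isOpen_ball.measurableSet)

lemma innerWeight_lt_top (hN : 1 ≤ N) {μ : ℝ} {q : ℝ≥0∞} (hq : 1 < q)
    (h : μ / N + (q⁻¹).toReal < 1) :
    eLpNorm ((Metric.ball (0 : EuclideanSpace ℝ (Fin N)) 1).indicator fun y => ‖y‖ ^ (-μ))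
        (1 - q⁻¹)⁻¹ volume < ⊤ := by
  have hlt : q⁻¹ < 1 := ENNReal.inv_lt_one.2 hq
  have hN0 : (0 : ℝ) < N := by exact_mod_cast hN
  refine (memLp_indicator_ball_norm_rpow_neg hN ?_ ?_ ?_).2
  · simp
  · exact ENNReal.inv_ne_top.2 (tsub_pos_of_lt hlt).ne'
  · rw [ENNReal.toReal_inv, ENNReal.toReal_sub_of_le hlt.le ENNReal.one_ne_top,
      ENNReal.toReal_one]
    have h1 : 0 < 1 - (q⁻¹).toReal := by
      rw [sub_pos, ← ENNReal.toReal_one]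
      exact (ENNReal.toReal_lt_toReal hlt.ne_top ENNReal.one_ne_top).2 hlt
    rw [← div_eq_mul_inv, div_lt_iff₀ h1]
    have := (div_lt_iff₀ hN0).1 (lt_sub_iff_add_lt.2 h)
    linarith

/-- Subtraction in `ℝ≥0∞` is truncated, so one Hölder triple covers both orders: if `q₁ ≤ q₂` the
weight exponent is `⊤` and the target is `q₁`; otherwise the target is `q₂`. -/
lemma eLpNorm_outerPart_le {δ : ℝ} {q₁ q₂ : ℝ≥0∞}
    {f : EuclideanSpace ℝ (Fin N) → ℝ} (hf : AEStronglyMeasurable f volume) :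
    eLpNorm (outerPart N δ f) (min q₁ q₂) volume ≤
      eLpNorm ((Metric.ball (0 : EuclideanSpace ℝ (Fin N)) 1)ᶜ.indicator fun y => ‖y‖ ^ (-δ))
        (q₂⁻¹ - q₁⁻¹)⁻¹ volume * eLpNorm f q₁ volume := by
  have : ENNReal.HolderTriple (q₂⁻¹ - q₁⁻¹)⁻¹ q₁ (min q₁ q₂) := ⟨by
    rw [inv_inv, tsub_add_eq_max, max_comm]
    rcases le_total q₁ q₂ with h | h
    · rw [min_eq_left h, max_eq_left (ENNReal.inv_le_inv.2 h)]
    · rw [min_eq_right h, max_eq_right (ENNReal.inv_le_inv.2 h)]⟩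
  exact eLpNorm_smul_le_mul_eLpNorm hf (Measurable.aestronglyMeasurable <|
    Measurable.indicator (by fun_prop) Metric.isOpen_ball.measurableSet.compl)

lemma outerWeight_lt_top (hN : 1 ≤ N) {δ : ℝ} {q₁ q₂ : ℝ≥0∞} (hδ : 0 ≤ δ) (hq₂ : 1 < q₂)
    (h : (q₂⁻¹).toReal < δ / N + (q₁⁻¹).toReal) :
    eLpNorm ((Metric.ball (0 : EuclideanSpace ℝ (Fin N)) 1)ᶜ.indicator fun y => ‖y‖ ^ (-δ))
        (q₂⁻¹ - q₁⁻¹)⁻¹ volume < ⊤ := by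
  have hN0 : (0 : ℝ) < N := by exact_mod_cast hN
  have h2 : q₂⁻¹ ≠ ⊤ := ENNReal.inv_ne_top.2 (zero_lt_one.trans hq₂).ne'
  refine (memLp_indicator_compl_ball_norm_rpow_neg hδ ?_ fun hs => ?_).2
  · exact ENNReal.inv_ne_zero.2 (ENNReal.sub_ne_top h2)
  · have hlt : q₁⁻¹ < q₂⁻¹ := tsub_pos_iff_lt.1 (pos_iff_ne_zero.2 (ENNReal.inv_ne_top.1 hs))
    have hpos := (ENNReal.toReal_lt_toReal hlt.ne_top h2).2 hlt
    rw [ENNReal.toReal_inv, ENNReal.toReal_sub_of_le hlt.le h2, ← div_eq_mul_inv,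
      lt_div_iff₀ (by linarith)]
    have := (lt_div_iff₀ hN0).1 (sub_lt_iff_lt_add.2 h)
    linarith

lemma aestronglyMeasurable_heatSemigroup (t : ℝ) {u : EuclideanSpace ℝ (Fin N) → ℝ}
    (hu : AEStronglyMeasurable u volume) : AEStronglyMeasurable (heatSemigroup N t u) volume := by
  unfold heatSemigroup
  refine AEStronglyMeasurable.integral_prod_right'
    (f := fun z : EuclideanSpace ℝ (Fin N) × EuclideanSpace ℝ (Fin N) =>
      heatKernel N t (z.1 - z.2) * u z.2) ?_
  refine AEStronglyMeasurable.mul (Measurable.aestronglyMeasurable (by fun_prop)) hu.comp_snd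

/-- The weighted estimate for the heat semigroup at time `1`. -/
lemma exists_bound_heatSemigroup_one (hN : 1 ≤ N) {γ μ : ℝ} {q₁ q₂ : ℝ≥0∞}
    (hγ : 0 ≤ γ) (hγμ : γ ≤ μ) (hq₁ : 1 < q₁) (hq₂ : 1 < q₂)
    (h₁ : (q₂⁻¹).toReal < (μ - γ) / N + (q₁⁻¹).toReal)
    (h₂ : μ / N + (q₁⁻¹).toReal < 1) :
    ∃ C : ℝ≥0∞, C ≠ ⊤ ∧ ∀ u : EuclideanSpace ℝ (Fin N) → ℝ,
      AEStronglyMeasurable (weighted N μ u) volume →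
        (∀ x, ∫⁻ y, ‖heatKernel N 1 (x - y) * u y‖ₑ ≤ C * eLpNorm (weighted N μ u) q₁ volume) ∧
        eLpNorm (weighted N γ (heatSemigroup N 1 u)) q₂ volume ≤
          C * eLpNorm (weighted N μ u) q₁ volume := by
  obtain ⟨A, hA0, hA, hkA, hkI⟩ := exists_bound_momentKernel N hγ
  have hk := measurable_momentKernel (N := N) γ
  set W₁ := eLpNorm ((Metric.ball (0 : EuclideanSpace ℝ (Fin N)) 1).indicator
    fun y => ‖y‖ ^ (-μ)) (1 - q₁⁻¹)⁻¹ volume with hW₁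
  set W₂ := eLpNorm ((Metric.ball (0 : EuclideanSpace ℝ (Fin N)) 1)ᶜ.indicator
    fun y => ‖y‖ ^ (-(μ - γ))) (q₂⁻¹ - q₁⁻¹)⁻¹ volume with hW₂
  have hW₁' : W₁ < ⊤ := innerWeight_lt_top hN hq₁ h₂
  have hW₂' : W₂ < ⊤ := outerWeight_lt_top hN (sub_nonneg.2 hγμ) hq₂ h₁
  refine ⟨A * (W₁ + W₂), by finiteness, fun u hu => ?_⟩
  set f := weighted N μ u
  have hr : 1 ≤ min q₁ q₂ := le_min hq₁.le hq₂.le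
  have hi := aestronglyMeasurable_innerPart (α := μ) hu
  have ho := aestronglyMeasurable_outerPart (α := μ - γ) hu
  have hni : eLpNorm (innerPart N μ f) 1 volume ≤ W₁ * eLpNorm f q₁ volume :=
    eLpNorm_innerPart_le hq₁ hu
  have hno : eLpNorm (outerPart N (μ - γ) f) (min q₁ q₂) volume ≤ W₂ * eLpNorm f q₁ volume :=
    eLpNorm_outerPart_le hu
  set Φ₁ : EuclideanSpace ℝ (Fin N) → ℝ≥0∞ :=
    fun x => ∫⁻ y, momentKernel N γ (x - y) * ‖innerPart N μ f y‖ₑ with hΦ₁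
  set Φ₂ : EuclideanSpace ℝ (Fin N) → ℝ≥0∞ :=
    fun x => ∫⁻ y, momentKernel N γ (x - y) * ‖outerPart N (μ - γ) f y‖ₑ with hΦ₂
  -- The factor `max 1 (|x|^γ)` serves both claims: `1` for absolute convergence, `|x|^γ` for the
  -- weighted norm.
  have key : ∀ x, ENNReal.ofReal (max 1 (‖x‖ ^ γ)) *
      ∫⁻ y, ‖heatKernel N 1 (x - y) * u y‖ₑ ≤ Φ₁ x + Φ₂ x := fun x => by
    rw [hΦ₁, hΦ₂, ← lintegral_const_mul' _ _ ENNReal.ofReal_ne_top, ← lintegral_add_left']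
    · refine lintegral_mono_ae ?_
      filter_upwards [ae_ne_zero hN] with y hy
      exact weight_mul_enorm_le hγ u x hy
    · exact (hk.comp (measurable_const.sub measurable_id)).aemeasurable.mul hi.enorm
  have hsum : ∀ {a b : ℝ≥0∞}, a ≤ A * eLpNorm (innerPart N μ f) 1 volume →
      b ≤ A * eLpNorm (outerPart N (μ - γ) f) (min q₁ q₂) volume →
      a + b ≤ A * (W₁ + W₂) * eLpNorm f q₁ volume := fun {a b} ha hb => by
    calc a + b ≤ A * (W₁ * eLpNorm f q₁ volume) + A * (W₂ * eLpNorm f q₁ volume) :=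
          add_le_add (ha.trans (by gcongr)) (hb.trans (by gcongr))
      _ = _ := by ring
  constructor
  · intro x
    refine le_trans ?_ ((key x).trans (hsum
      (lintegral_convolution_le hk hA0 hA hkA hkI hi le_rfl x)
      (lintegral_convolution_le hk hA0 hA hkA hkI ho hr x)))
    refine le_mul_of_one_le_left' ?_
    rw [← ENNReal.ofReal_one]
    exact ENNReal.ofReal_le_ofReal (le_max_left _ _)
  · have h3 : eLpNorm (weighted N γ (heatSemigroup N 1 u)) q₂ volume ≤
        eLpNorm (Φ₁ + Φ₂) q₂ volume := by
      refine eLpNorm_mono_enorm fun x => le_trans ?_ (key x)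
      unfold weighted heatSemigroup
      rw [enorm_mul, Real.enorm_of_nonneg (by positivity)]
      gcongr
      · exact le_max_right _ _
      · exact enorm_integral_le_lintegral_enorm _
    refine h3.trans ((eLpNorm_add_le ?_ ?_ hq₂.le).trans (hsum
      (eLpNorm_lintegral_convolution_le hk hA0 hA hkA hkI hi le_rfl hq₂.le)
      (eLpNorm_lintegral_convolution_le hk hA0 hA hkA hkI ho hr (min_le_right _ _))))
    · exact (aemeasurable_kernel_mul hk hi.enorm).lintegral_prod_right'.aestronglyMeasurable
    · exact (aemeasurable_kernel_mul hk ho.enorm).lintegral_prod_right'.aestronglyMeasurable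

end UnitTime

/-! ### Parabolic scaling and the general time -/

section Scaling

variable {N : ℕ}

lemma eLpNorm_comp_smul {l : ℝ} (hl : 0 < l) (f : EuclideanSpace ℝ (Fin N) → ℝ) (q : ℝ≥0∞) :
    eLpNorm (fun x => f (l • x)) q volume =
      ENNReal.ofReal (l ^ (-(N * (q⁻¹).toReal))) * eLpNorm f q volume := by
  have he : MeasurableEmbedding fun x : EuclideanSpace ℝ (Fin N) => l • x :=
    measurableEmbedding_const_smul₀ hl.ne'
  have hc : (0 : ℝ) < (l ^ N)⁻¹ := by positivity
  rw [show (fun x => f (l • x)) = f ∘ fun x => l • x from rfl, ← he.eLpNorm_map_measure,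
    Measure.map_addHaar_smul volume hl.ne', finrank_euclideanSpace, Fintype.card_fin,
    abs_of_pos hc, eLpNorm_smul_measure_of_ne_zero (ENNReal.ofReal_pos.2 hc).ne', smul_eq_mul,
    ENNReal.ofReal_rpow_of_pos hc, one_div, ← Real.rpow_natCast, ← Real.rpow_neg hl.le,
    ← Real.rpow_mul hl.le, neg_mul]

lemma heatKernel_smul {l : ℝ} (hl : 0 < l) (z : EuclideanSpace ℝ (Fin N)) :
    heatKernel N (l ^ 2) (l • z) = (l ^ N)⁻¹ * heatKernel N 1 z := by
  unfold heatKernel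
  have h1 : (4 * Real.pi * l ^ 2) ^ (-((N : ℝ) / 2)) =
      (l ^ N)⁻¹ * (4 * Real.pi * 1) ^ (-((N : ℝ) / 2)) := by
    rw [Real.mul_rpow (by positivity) (by positivity), mul_one, mul_comm, ← Real.rpow_natCast l 2,
      ← Real.rpow_mul hl.le, ← Real.rpow_natCast, ← Real.rpow_neg hl.le]
    congr 2; push_cast; ring
  have h2 : -(‖l • z‖ ^ 2) / (4 * l ^ 2) = -(‖z‖ ^ 2) / (4 * 1) := by
    rw [norm_smul, Real.norm_of_nonneg hl.le]
    field_simp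
  rw [h1, h2, mul_assoc]

lemma weighted_comp_smul {l : ℝ} (hl : 0 < l) (α : ℝ) (f : EuclideanSpace ℝ (Fin N) → ℝ) :
    weighted N α (fun y => f (l • y)) = l ^ (-α) • fun y => weighted N α f (l • y) := by
  ext y
  simp only [weighted, Pi.smul_apply, smul_eq_mul, norm_smul, Real.norm_of_nonneg hl.le]
  rw [Real.mul_rpow hl.le (norm_nonneg _), ← mul_assoc, ← mul_assoc, ← Real.rpow_add hl,
    neg_add_cancel, Real.rpow_zero, one_mul]

lemma eLpNorm_weighted_comp_smul {l : ℝ} (hl : 0 < l) (α : ℝ)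
    (f : EuclideanSpace ℝ (Fin N) → ℝ) (q : ℝ≥0∞) :
    eLpNorm (weighted N α fun y => f (l • y)) q volume =
      ENNReal.ofReal (l ^ (-α - N * (q⁻¹).toReal)) * eLpNorm (weighted N α f) q volume := by
  rw [weighted_comp_smul hl, eLpNorm_const_smul, eLpNorm_comp_smul hl, ← mul_assoc,
    Real.enorm_of_nonneg (by positivity), ← ENNReal.ofReal_mul (by positivity),
    ← Real.rpow_add hl, ← sub_eq_add_neg]

lemma integrable_heatKernel_mul_iff {l : ℝ} (hl : 0 < l) (u : EuclideanSpace ℝ (Fin N) → ℝ)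
    (x : EuclideanSpace ℝ (Fin N)) :
    Integrable (fun y => heatKernel N (l ^ 2) (l • x - y) * u y) volume ↔
      Integrable (fun y => heatKernel N 1 (x - y) * u (l • y)) volume := by
  rw [← integrable_comp_smul_iff volume _ hl.ne']
  simp_rw [← smul_sub, heatKernel_smul hl, mul_assoc]
  exact integrable_const_mul_iff (IsUnit.mk0 _ (by positivity)) _

/-- The Jacobian of `y ↦ l • y` cancels the factor `l^{-N}` from `heatKernel_smul`. -/
lemma heatSemigroup_smul {l : ℝ} (hl : 0 < l) (u : EuclideanSpace ℝ (Fin N) → ℝ)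
    (x : EuclideanSpace ℝ (Fin N)) :
    heatSemigroup N (l ^ 2) u (l • x) = heatSemigroup N 1 (fun y => u (l • y)) x := by
  have h := Measure.integral_comp_smul volume
    (fun y => heatKernel N (l ^ 2) (l • x - y) * u y) l
  simp_rw [← smul_sub, heatKernel_smul hl, mul_assoc] at h
  rw [integral_const_mul, finrank_euclideanSpace, Fintype.card_fin,
    abs_of_pos (by positivity), smul_eq_mul] at h
  exact (mul_left_cancel₀ (by positivity) h).symm

end Scaling

theorem proposition3p1 (N : ℕ) (hN : 1 ≤ N) (γ μ : ℝ) (q₁ q₂ : ℝ≥0∞)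
    (hγ : 0 ≤ γ) (hγμ : γ ≤ μ) (hμ : μ < N) (hq₁ : 1 < q₁) (hq₂ : 1 < q₂)
    (h₁ : (q₂⁻¹).toReal < (μ - γ) / N + (q₁⁻¹).toReal)
    (h₂ : μ / N + (q₁⁻¹).toReal < 1) :
    ∃ C : ℝ, 0 < C ∧
      ∀ t : ℝ, 0 < t → ∀ u : EuclideanSpace ℝ (Fin N) → ℝ,
        MemLp (weighted N μ u) q₁ volume →
          (∀ x, Integrable (fun y => heatKernel N t (x - y) * u y) volume) ∧
          MemLp (weighted N γ (heatSemigroup N t u)) q₂ volume ∧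
          eLpNorm (weighted N γ (heatSemigroup N t u)) q₂ volume ≤
            ENNReal.ofReal
              (C * t ^ (-((N : ℝ) / 2) * ((q₁⁻¹).toReal - (q₂⁻¹).toReal) - (μ - γ) / 2)) *
              eLpNorm (weighted N μ u) q₁ volume := by
  obtain ⟨C, hC, hbound⟩ := exists_bound_heatSemigroup_one hN hγ hγμ hq₁ hq₂ h₁ h₂
  -- Adding `1` makes the constant positive even if `C = 0`.
  refine ⟨C.toReal + 1, by positivity, fun t ht u hu => ?_⟩
  obtain ⟨l, hl, rfl⟩ : ∃ l : ℝ, 0 < l ∧ t = l ^ 2 :=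
    ⟨√t, Real.sqrt_pos.2 ht, (Real.sq_sqrt ht.le).symm⟩
  have hum : AEStronglyMeasurable u volume := aestronglyMeasurable_of_weighted hN hu.1
  have hqmp := Measure.quasiMeasurePreserving_smul
    (volume : Measure (EuclideanSpace ℝ (Fin N))) hl.ne'
  have hvm : AEStronglyMeasurable (fun y => u (l • y)) volume :=
    hum.comp_quasiMeasurePreserving hqmp
  have hvw : AEStronglyMeasurable (weighted N μ fun y => u (l • y)) volume :=
    AEStronglyMeasurable.mul (Measurable.aestronglyMeasurable (by fun_prop)) hvm
  obtain ⟨hpt, hnorm⟩ := hbound _ hvw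
  rw [eLpNorm_weighted_comp_smul hl] at hpt hnorm
  have hnorm_le : eLpNorm (weighted N γ (heatSemigroup N (l ^ 2) u)) q₂ volume ≤
      ENNReal.ofReal ((C.toReal + 1) * (l ^ 2) ^
        (-((N : ℝ) / 2) * ((q₁⁻¹).toReal - (q₂⁻¹).toReal) - (μ - γ) / 2)) *
        eLpNorm (weighted N μ u) q₁ volume := by
    have hs : heatSemigroup N 1 (fun y => u (l • y)) =
        fun x => heatSemigroup N (l ^ 2) u (l • x) :=
      funext fun x => (heatSemigroup_smul hl u x).symm
    rw [hs, eLpNorm_weighted_comp_smul hl] at hnorm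
    set X := eLpNorm (weighted N γ (heatSemigroup N (l ^ 2) u)) q₂ volume
    set Y := eLpNorm (weighted N μ u) q₁ volume
    calc X = ENNReal.ofReal (l ^ (γ + N * (q₂⁻¹).toReal)) *
          (ENNReal.ofReal (l ^ (-γ - N * (q₂⁻¹).toReal)) * X) := by
          rw [← mul_assoc, ← ENNReal.ofReal_mul (by positivity), ← Real.rpow_add hl]
          ring_nf
          simp
      _ ≤ ENNReal.ofReal (l ^ (γ + N * (q₂⁻¹).toReal)) *
          (C * (ENNReal.ofReal (l ^ (-μ - N * (q₁⁻¹).toReal)) * Y)) := by gcongr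
      _ = C * (ENNReal.ofReal (l ^ (γ + N * (q₂⁻¹).toReal)) *
          ENNReal.ofReal (l ^ (-μ - N * (q₁⁻¹).toReal))) * Y := by ring
      _ ≤ ENNReal.ofReal (C.toReal + 1) * ENNReal.ofReal ((l ^ 2) ^
          (-((N : ℝ) / 2) * ((q₁⁻¹).toReal - (q₂⁻¹).toReal) - (μ - γ) / 2)) * Y := by
          gcongr
          · rw [← ENNReal.ofReal_toReal hC, ENNReal.toReal_ofReal ENNReal.toReal_nonneg]
            exact ENNReal.ofReal_le_ofReal (by linarith)
          -- Both sides are `l` to the power `γ - μ + N(1/q₂ - 1/q₁)`.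
          · rw [← ENNReal.ofReal_mul (by positivity), ← Real.rpow_add hl, ← Real.rpow_natCast l 2,
              ← Real.rpow_mul hl.le]
            refine le_of_eq ?_
            congr 2
            push_cast
            ring
      _ = _ := by rw [← ENNReal.ofReal_mul (by positivity)]
  refine ⟨fun x => ?_, ⟨?_, hnorm_le.trans_lt ?_⟩, hnorm_le⟩
  · obtain ⟨x, rfl⟩ : ∃ z, x = l • z := ⟨l⁻¹ • x, (smul_inv_smul₀ hl.ne' x).symm⟩
    rw [integrable_heatKernel_mul_iff hl]
    refine ⟨AEStronglyMeasurable.mul (Measurable.aestronglyMeasurable (by fun_prop)) hvm,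
      (hpt x).trans_lt ?_⟩
    exact ENNReal.mul_lt_top hC.lt_top (ENNReal.mul_lt_top ENNReal.ofReal_lt_top hu.2)
  · exact AEStronglyMeasurable.mul (Measurable.aestronglyMeasurable (by fun_prop))
      (aestronglyMeasurable_heatSemigroup _ hum)
  · exact ENNReal.mul_lt_top ENNReal.ofReal_lt_top hu.2
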